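/- Let $m,n\ge 0$, let $M\in\mathbb F_2^{m\times n}$ and let $b,b'\in\mathbb F_2^m$ with $b\neq b'$. Write $S_k=\{i\in[n]: M_{ki}=1\}$ for $k\in[m]$. Definitions. For $c\in\mathbb F_2^m$: (a) $G(M,c)$ is the following vertex- and edge-colored graph. Its vertices are the pairs $(k,\alpha)$ with $k\in[m]$ and $\alpha:S_k\to\{1,-1\}$ such that $\prod_{i\in S_k}\alpha_i=(-1)^{c_k}$; the vertex $(k,\alpha)$ has color $k$. Two distinct vertices $(l,\alpha)$ and $(k,\beta)$ are adjacent if and only if $S_l\cap S_k\ne\varnothing$, and the edge between them is colored by the function $S_l\cap S_k\to\{1,-1\}$, $i\mapsto\alpha_i\beta_i$. (b) $\mathcal A(M,c)$ is the universal unital $C^*$-algebra generated by elements $x_1,\dots,x_n$ subject to the relations $x_i=x_i^*$ and $x_i^2=1$ for all $i\in[n]$; $x_ix_j=x_jx_i$ whenever $i,j\in S_k$ for some $k\in[m]$; and $\prod_{i\in S_k}x_i=(-1)^{c_k}1$ for all $k\in[m]$. It is nontrivial if $\mathcal A(M,c)\ne\{0\}$. (c) For $c\ne0$, the solution group $\Gamma(M,c)$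 is the group generated by $x_1,\dots,x_n,\gamma$ subject to the relations $x_i^2=1$ for all $i$; $x_ix_j=x_jx_i$ whenever $i,j\in S_k$ for some $k$; $\prod_{i\in S_k}x_i=\gamma^{c_k}$ for all $k$; $\gamma^2=1$; and $x_i\gamma=\gamma x_i$ for all $i$. (d) Let $G,G'$ be finite colored graphs with disjoint vertex sets $V,V'$ and coloring functions $c,c'$. In the $(G,G')$-isomorphism game Alice and Bob each receive an element of $V\cup V'$ and each answer with an element of $V\cup V'$. They lose unless each player who receives a vertex of one graph answers with a vertex of the other graph. If this holds, let $g_A\in V$ and $g_A'\in V'$ be the two vertices consisting of Alice's input and output, and define $g_B\in V$, $g_B'\in V'$ in the same way for Bob; then they win if and only if $c(g_A)=c'(g_A')$ and $c(g_B)=c'(g_B')$; $g_A=g_B\iff g_A'=g_B'$; and, for every color $s$, $g_Ag_B$ is an edge of $G$ of color $s$ if and only if $g'_Ag'_B$ is an edge of $G'$ of color $s$. A (commuting-operator) quantum strategy consists of a complex Hilbert space $H$, a unit vector $\psi\in H$, and for every input $x$ POVMs $(A_{x,y})_y$ and $(B_{x,y})_y$ of bounded operators on $H$ indexed by the outputs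 $y$, such that every $A_{x,y}$ commutes with every $B_{x',y'}$; on inputs $x,x'$ the outputs are $y,y'$ with probability $\langle\psi,A_{x,y}B_{x',y'}\psi\rangle$. There is a quantum isomorphism from $G$ to $G'$ (that is, $G$ and $G'$ are quantum isomorphic) if some quantum strategy wins the $(G,G')$-isomorphism game with probability $1$ on every pair of inputs. Corollary. The following are equivalent: (1) there is a quantum isomorphism from $G(M,b)$ to $G(M,b')$; (2) the algebra $\mathcal A(M,b+b')$ is nontrivial; (3) the element $\gamma$ of the solution group $\Gamma(M,b+b')$ is not equal to the identity. -/

import Mathlib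

open scoped ENNReal

universe u v

namespace QIso

/-! ### Linear systems over `𝔽₂` -/

section Supports

variable {m n : ℕ}

/-- The support `S_k = {i : M_{ki} = 1}` of the `k`-th equation. -/
def supp (M : Matrix (Fin m) (Fin n) (ZMod 2)) (k : Fin m) : Finset (Fin n) :=
  Finset.univ.filter fun i => M k i = 1

/-- The product `∏_{i ∈ S_k} x_i` in a (not necessarily commutative) monoid, in increasing order
of `i`.  It is only used where the factors commute, so that the order is irrelevant. -/
def rowProd {G : Type*} [Monoid G] (M : Matrix (Fin m) (Fin n) (ZMod 2)) (x : Fin n → G)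
    (k : Fin m) : G :=
  (((List.finRange n).filter fun i => M k i = 1).map x).prod

end Supports

/-! ### Solution groups -/

section SolutionGroup

variable {m n : ℕ}

/-- The relations of the solution group `Γ(M,b)`, as words in the free group on the generators
`x_i` (`some i`) and `γ` (`none`).  A word `w` stands for the relation `w = 1`.  The relation
`γ = 1` is added in the homogeneous case `b = 0`. -/
inductive SolGroupRel (M : Matrix (Fin m) (Fin n) (ZMod 2)) (b : Fin m → ZMod 2) :
    FreeGroup (Option (Fin n)) → Prop
  | sq (i : Fin n) : SolGroupRel M b (FreeGroup.of (some i) ^ 2)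
  | comm (i j : Fin n) (k : Fin m) (hi : M k i = 1) (hj : M k j = 1) :
      SolGroupRel M b
        (FreeGroup.of (some i) * FreeGroup.of (some j) *
          (FreeGroup.of (some i))⁻¹ * (FreeGroup.of (some j))⁻¹)
  | eqn (k : Fin m) :
      SolGroupRel M b
        (rowProd M (fun i => FreeGroup.of (some i)) k * (FreeGroup.of none ^ (b k).val)⁻¹)
  | gamma_sq : SolGroupRel M b (FreeGroup.of none ^ 2)
  | gamma_comm (i : Fin n) :
      SolGroupRel M b
        (FreeGroup.of (some i) * FreeGroup.of none * (FreeGroup.of (some i))⁻¹ * (FreeGroup.of none)⁻¹)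
  | homogeneous (hb : b = 0) : SolGroupRel M b (FreeGroup.of none)

/-- The solution group `Γ(M,b)` of the linear system `Mx = b`. -/
abbrev SolGroup (M : Matrix (Fin m) (Fin n) (ZMod 2)) (b : Fin m → ZMod 2) : Type :=
  PresentedGroup {w | SolGroupRel M b w}

/-- The element `γ` of the solution group. -/
def SolGroup.gamma (M : Matrix (Fin m) (Fin n) (ZMod 2)) (b : Fin m → ZMod 2) : SolGroup M b :=
  PresentedGroup.of none

end SolutionGroup

/-! ### The universal C⋆-algebra `𝒜(M,b)` -/

section SolutionAlgebra

variable {m n : ℕ}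

/-- The defining relations of `𝒜(M,b)` for elements `x_1, …, x_n` of a unital C⋆-algebra. -/
structure SolAlgRel (M : Matrix (Fin m) (Fin n) (ZMod 2)) (b : Fin m → ZMod 2)
    {B : Type*} [CStarAlgebra B] (x : Fin n → B) : Prop where
  star_eq : ∀ i, star (x i) = x i
  sq_eq : ∀ i, x i ^ 2 = 1
  comm : ∀ i j, (∃ k, M k i = 1 ∧ M k j = 1) → x i * x j = x j * x i
  eqn : ∀ k, rowProd M x k = (-1) ^ (b k).val

/-- A representation of the relations of `𝒜(M,b)` in some nonzero unital C⋆-algebra. -/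
structure SolRep (M : Matrix (Fin m) (Fin n) (ZMod 2)) (b : Fin m → ZMod 2) : Type (u + 1) where
  alg : Type u
  [cstar : CStarAlgebra alg]
  [nontriv : Nontrivial alg]
  gen : Fin n → alg
  rel : SolAlgRel M b gen

attribute [instance] SolRep.cstar SolRep.nontriv

variable (M : Matrix (Fin m) (Fin n) (ZMod 2)) (b : Fin m → ZMod 2)

/-- The `ℓ^∞`-product of all C⋆-algebras (in a universe) carrying a representation of the
relations. -/
abbrev RepProd : Type (u + 1) := lp (fun r : SolRep.{u} M b => r.alg) ∞

noncomputable instance RepProd.instCStarAlgebra : CStarAlgebra (RepProd.{u} M b) where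

theorem SolRep.norm_gen_le {M : Matrix (Fin m) (Fin n) (ZMod 2)} {b : Fin m → ZMod 2}
    (r : SolRep.{u} M b) (i : Fin n) : ‖r.gen i‖ ≤ 1 := by
  have h := CStarRing.norm_star_mul_self (x := r.gen i)
  rw [r.rel.star_eq, ← sq, r.rel.sq_eq, CStarRing.norm_one] at h
  nlinarith [norm_nonneg (r.gen i)]

/-- The tuple of all values of the `i`-th generator. -/
noncomputable def RepProd.gen (i : Fin n) : RepProd.{u} M b :=
  ⟨fun r => r.gen i, memℓp_infty ⟨1, by rintro _ ⟨r, rfl⟩; exact r.norm_gen_le i⟩⟩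

/-- `𝒜(M,b)` as a C⋆-subalgebra of the product: the closed unital ⋆-subalgebra generated by
the `x_i`. -/
noncomputable def solSubalgebra : StarSubalgebra ℂ (RepProd.{u} M b) :=
  (StarAlgebra.adjoin ℂ (Set.range (RepProd.gen M b))).topologicalClosure

instance isClosed_solSubalgebra :
    IsClosed (solSubalgebra.{u} M b : Set (RepProd.{u} M b)) :=
  StarSubalgebra.isClosed_topologicalClosure _

/-- The universal unital C⋆-algebra `𝒜(M,b)` generated by self-adjoint elements `x_1, …, x_n`
with `x_i² = 1`, `x_i x_j = x_j x_i` whenever `i, j` occur in a common equation, and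
`∏_{i ∈ S_k} x_i = (-1)^{b_k}`.  Its universal property is proved in `SolAlg.rel` and
`SolAlg.existsUnique_lift`.  It is the zero algebra if the relations cannot be satisfied in a
nonzero C⋆-algebra. -/
abbrev SolAlg : Type (u + 1) := solSubalgebra.{u} M b

/-- The generator `x_i` of `𝒜(M,b)`. -/
noncomputable def SolAlg.gen (i : Fin n) : SolAlg.{u} M b :=
  ⟨RepProd.gen M b i,
    StarSubalgebra.le_topologicalClosure _ (StarAlgebra.subset_adjoin ℂ _ ⟨i, rfl⟩)⟩

/-- Evaluation of `𝒜(M,b)` in a representation, as a unital ⋆-homomorphism. -/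
noncomputable def SolAlg.eval (r : SolRep.{u} M b) : SolAlg.{u} M b →⋆ₐ[ℂ] r.alg where
  toFun a := (a : RepProd.{u} M b) r
  map_one' := rfl
  map_mul' _ _ := rfl
  map_zero' := rfl
  map_add' _ _ := rfl
  commutes' _ := rfl
  map_star' _ := rfl

variable {M b} in
theorem SolAlg.ext_eval {a a' : SolAlg.{u} M b}
    (h : ∀ r : SolRep.{u} M b, SolAlg.eval M b r a = SolAlg.eval M b r a') : a = a' :=
  Subtype.ext (lp.ext (funext h))

theorem map_rowProd {M : Matrix (Fin m) (Fin n) (ZMod 2)} {G H : Type*} [Monoid G] [Monoid H]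
    {F : Type*} [FunLike F G H] [MonoidHomClass F G H] (f : F) (x : Fin n → G) (k : Fin m) :
    f (rowProd M x k) = rowProd M (fun i => f (x i)) k := by
  simp [rowProd, map_list_prod, Function.comp_def]

/-- The generators of `𝒜(M,b)` satisfy the defining relations. -/
theorem SolAlg.rel : SolAlgRel M b (SolAlg.gen.{u} M b) where
  star_eq i := SolAlg.ext_eval fun r => r.rel.star_eq i
  sq_eq i := SolAlg.ext_eval fun r => by
    rw [map_pow, map_one]; exact r.rel.sq_eq i
  comm i j h := SolAlg.ext_eval fun r => r.rel.comm i j h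
  eqn k := SolAlg.ext_eval fun r => by
    rw [map_rowProd, map_pow, map_neg, map_one]; exact r.rel.eqn k

/-- The universal property of `𝒜(M,b)`. -/
theorem SolAlg.existsUnique_lift {B : Type u} [CStarAlgebra B] (y : Fin n → B)
    (hy : SolAlgRel M b y) :
    ∃! φ : SolAlg.{u} M b →⋆ₐ[ℂ] B, ∀ i, φ (SolAlg.gen M b i) = y i := by
  refine existsUnique_of_exists_of_unique ?_ ?_
  · rcases subsingleton_or_nontrivial B with hB | hB
    · exact ⟨{ toFun := fun _ => 0
               map_one' := Subsingleton.elim _ _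
               map_mul' := fun _ _ => Subsingleton.elim _ _
               map_zero' := rfl
               map_add' := fun _ _ => Subsingleton.elim _ _
               commutes' := fun _ => Subsingleton.elim _ _
               map_star' := fun _ => Subsingleton.elim _ _ }, fun _ => Subsingleton.elim _ _⟩
    · exact ⟨SolAlg.eval M b ⟨B, y, hy⟩, fun _ => rfl⟩
  · intro φ ψ hφ hψ
    have hc (χ : SolAlg.{u} M b →⋆ₐ[ℂ] B) : Continuous χ :=
      AddMonoidHomClass.continuous_of_bound χ 1 fun x => by
        rw [one_mul]; exact NonUnitalStarAlgHom.norm_apply_le χ x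
    refine StarAlgHom.ext_topologicalClosure (hc φ) (hc ψ) ?_
    refine StarAlgHom.ext_adjoin ?_
    rintro ⟨_, _⟩ ⟨i, rfl⟩
    exact (hφ i).trans (hψ i).symm

end SolutionAlgebra

/-! ### Colored graphs and the isomorphism game -/

section Game

/-- A vertex- and edge-colored graph with colors in `S`. -/
structure ColoredGraph (V S : Type*) where
  graph : SimpleGraph V
  vertexColor : V → S
  edgeColor : graph.EdgeLabeling S

/-- `(v, w)` is an edge of color `s`. -/
def ColoredGraph.IsEdge {V S : Type*} (G : ColoredGraph V S) (s : S) (v w : V) : Prop :=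
  (G.edgeColor.labelGraph s).Adj v w

/-- The question-answer pair `(x, y)` consists, in either order, of the vertex `g` of the first
graph and the vertex `g'` of the second graph. -/
def Pairs {V V' : Type*} (x y : V ⊕ V') (g : V) (g' : V') : Prop :=
  (x = .inl g ∧ y = .inr g') ∨ (x = .inr g' ∧ y = .inl g)

/-- The winning condition of the `(G, G')`-isomorphism game: Alice answers `yA` to `xA` and Bob
answers `yB` to `xB`. -/
def IsoGameWin {V V' S : Type*} (G : ColoredGraph V S) (G' : ColoredGraph V' S)
    (xA xB yA yB : V ⊕ V') : Prop :=
  ∃ (gA gB : V) (gA' gB' : V'), Pairs xA yA gA gA' ∧ Pairs xB yB gB gB' ∧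
    (G.vertexColor gA = G'.vertexColor gA' ∧ G.vertexColor gB = G'.vertexColor gB') ∧
    (gA = gB ↔ gA' = gB') ∧
    ∀ s : S, G.IsEdge s gA gB ↔ G'.IsEdge s gA' gB'

/-- A quantum strategy in the commuting-operator framework, for a two-player game in which both
players have inputs in `I` and outputs in `O`: a unit vector in a Hilbert space, and for each
input of each player a POVM indexed by the outputs, such that Alice's operators commute with
Bob's. -/
structure CommutingStrategy (I O : Type*) [Fintype O] where
  H : Type v
  [normed : NormedAddCommGroup H]
  [inner : InnerProductSpace ℂ H]
  [complete : CompleteSpace H]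
  state : H
  norm_state : ‖state‖ = 1
  alice : I → O → H →L[ℂ] H
  bob : I → O → H →L[ℂ] H
  alice_pos : ∀ x y, (alice x y).IsPositive
  bob_pos : ∀ x y, (bob x y).IsPositive
  alice_sum : ∀ x, ∑ y, alice x y = 1
  bob_sum : ∀ x, ∑ y, bob x y = 1
  commute : ∀ xA yA xB yB, Commute (alice xA yA) (bob xB yB)

attribute [instance] CommutingStrategy.normed CommutingStrategy.inner CommutingStrategy.complete

/-- The probability `⟨ψ, A_{xA,yA} B_{xB,yB} ψ⟩` of the answers `yA, yB` to `xA, xB`. -/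
noncomputable def CommutingStrategy.prob {I O : Type*} [Fintype O]
    (σ : CommutingStrategy.{v} I O) (xA xB : I) (yA yB : O) : ℝ :=
  (Inner.inner ℂ σ.state (σ.alice xA yA (σ.bob xB yB σ.state))).re

open Classical in
/-- The strategy wins with probability `1` on every pair of inputs. -/
def CommutingStrategy.IsPerfect {I O : Type*} [Fintype O]
    (σ : CommutingStrategy.{v} I O) (win : I → I → O → O → Prop) : Prop :=
  ∀ xA xB, ∑ yA, ∑ yB, (if win xA xB yA yB then σ.prob xA xB yA yB else 0) = 1

/-- Quantum isomorphism of finite colored graphs: the isomorphism game has a perfect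
commuting-operator strategy (on a Hilbert space in the universe `v`). -/
def QuantumIsomorphic {V V' S : Type*} [Fintype V] [Fintype V']
    (G : ColoredGraph V S) (G' : ColoredGraph V' S) : Prop :=
  ∃ σ : CommutingStrategy.{v} (V ⊕ V') (V ⊕ V'), σ.IsPerfect (IsoGameWin G G')

end Game

/-! ### The colored graph `G(M,b)` -/

section SolGraph

variable {m n : ℕ}

/-- The vertices of `G(M,b)`: pairs `(k, α)` with `α : S_k → {1, -1}` and
`∏_{i ∈ S_k} α_i = (-1)^{b_k}`. -/
abbrev SolVertex (M : Matrix (Fin m) (Fin n) (ZMod 2)) (b : Fin m → ZMod 2) : Type :=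
  Σ k : Fin m, {α : supp M k → ℤˣ // ∏ i, α i = (-1) ^ (b k).val}

/-- The colors of `G(M,b)`: a row index `k` (for vertices), or a function `T → {1, -1}` together
with its domain `T ⊆ [n]` (for edges). -/
abbrev SolColor (m n : ℕ) : Type := Fin m ⊕ (Σ T : Finset (Fin n), T → ℤˣ)

/-- The function `α △ β` on `T ∩ T'`, together with its domain. -/
def triangle {T T' : Finset (Fin n)} (α : T → ℤˣ) (β : T' → ℤˣ) :
    Σ T : Finset (Fin n), T → ℤˣ :=
  ⟨T ∩ T', fun i => α ⟨i, (Finset.mem_inter.1 i.2).1⟩ * β ⟨i, (Finset.mem_inter.1 i.2).2⟩⟩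

theorem triangle_comm {T T' : Finset (Fin n)} (α : T → ℤˣ) (β : T' → ℤˣ) :
    triangle β α = triangle α β := by
  have key : ∀ (U U' : Finset (Fin n)) (h : U = U') (f : U → ℤˣ) (f' : U' → ℤˣ),
      (∀ i (hi : i ∈ U) (hi' : i ∈ U'), f ⟨i, hi⟩ = f' ⟨i, hi'⟩) →
      (⟨U, f⟩ : Σ T : Finset (Fin n), T → ℤˣ) = ⟨U', f'⟩ := by
    rintro U _ rfl f f' h
    exact congrArg (Sigma.mk U) (funext fun i => h i i.2 i.2)
  exact key _ _ (Finset.inter_comm _ _) _ _ fun i _ _ => mul_comm _ _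

/-- The colored graph `G(M,b)`.  Distinct vertices `(l, α)` and `(k, β)` are adjacent iff
`S_l ∩ S_k ≠ ∅`, and the edge between them has color `α △ β`. -/
def solGraph (M : Matrix (Fin m) (Fin n) (ZMod 2)) (b : Fin m → ZMod 2) :
    ColoredGraph (SolVertex M b) (SolColor m n) where
  graph :=
    { Adj := fun v w => v ≠ w ∧ (supp M v.1 ∩ supp M w.1).Nonempty
      symm := ⟨fun v w h => ⟨h.1.symm, by rw [Finset.inter_comm]; exact h.2⟩⟩
      loopless := ⟨fun v h => h.1 rfl⟩ }
  vertexColor v := .inl v.1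
  edgeColor := SimpleGraph.EdgeLabeling.mk (fun v w _ => .inr (triangle v.2.1 w.2.1))
    fun v w _ => congrArg Sum.inr (triangle_comm v.2.1 w.2.1)

end SolGraph

end QIso

namespace QIso

/-! ### Relations of the solution group, and a ring-valued criterion for `γ ≠ 1`. -/

section Relations

variable {m n : ℕ} {M : Matrix (Fin m) (Fin n) (ZMod 2)}

/-! Everything passes through the solution group, with `c = b + b'`. If some ring with `-1 ≠ 1`
contains solutions of the relations, then Γ maps to its units with `γ ↦ -1`, so `γ ≠ 1`
(`RingRel.gamma_ne_one`). The generators of a nonzero 𝒜 are such solutions. So are observables built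
from a perfect strategy: synchronicity gives `A ψ = B ψ`, so the losing products of Alice's
operators vanish on the whole space generated from `ψ` by Bob's operators (`IsPerfect.exists_ring`).
The signed sum `x_i = ∑ α_i α'_i F g g'` then depends only on `i`, and its row products carry the
sign `(-1)^(b_k + b'_k)` (`MagicFamily.exists_ringRel`). Conversely, if `γ ≠ 1`, the functions in
`ℓ²(Γ)` on which the central involution `γ` acts as `-1` form a nonzero Hilbert space with commuting
left and right translations (`exists_biregular_rep`). Left translation alone represents 𝒜. For the
game, Alice measures joint spectral projections of the left translations and Bob those of the right
ones. The involutions `x_i` act alike from both sides on the normalization of `δ_1 - δ_γ`, which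
makes the strategy perfect (`quantumIsomorphic_of_commuting_reps`). -/

theorem mem_supp {k : Fin m} {i : Fin n} : i ∈ supp M k ↔ M k i = 1 := by
  simp [supp]

theorem rowProd_congr {G : Type*} [Monoid G] {k : Fin m} {x y : Fin n → G}
    (h : ∀ i, M k i = 1 → x i = y i) : rowProd M x k = rowProd M y k := by
  unfold rowProd
  congr 1
  exact List.map_congr_left fun i hi => h i (by simpa using hi)

theorem rowProd_eq_prod {G : Type*} [CommMonoid G] (x : Fin n → G) (k : Fin m) :
    rowProd M x k = ∏ i ∈ supp M k, x i := by
  have hnd : ((List.finRange n).filter fun i => M k i = 1).Nodup :=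
    (List.nodup_finRange n).filter _
  have hs : supp M k = ((List.finRange n).filter fun i => M k i = 1).toFinset := by
    ext i; simp [supp]
  rw [hs, List.prod_toFinset _ hnd, rowProd]

/-- The relations of the solution group, for elements `x_i` and `-1` of a ring. -/
structure RingRel (M : Matrix (Fin m) (Fin n) (ZMod 2)) (c : Fin m → ZMod 2)
    {R : Type*} [Ring R] (x : Fin n → R) : Prop where
  sq_eq : ∀ i, x i * x i = 1
  comm : ∀ k i j, M k i = 1 → M k j = 1 → x i * x j = x j * x i
  eqn : ∀ k, rowProd M x k = (-1) ^ (c k).val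

/-- The assignment of `x i` to the generators and `-1` to `γ` respects all relations, so `γ = 1`
would give `-1 = 1` in `R`. The condition `c ≠ 0` rules out the relation `γ = 1` of the homogeneous
case. -/
theorem RingRel.gamma_ne_one {c : Fin m → ZMod 2} (hc : c ≠ 0) {R : Type*} [Ring R]
    (hR : (-1 : R) ≠ 1) {x : Fin n → R} (h : RingRel M c x) : SolGroup.gamma M c ≠ 1 := by
  let y : Fin n → Rˣ := fun i => ⟨x i, x i, h.sq_eq i, h.sq_eq i⟩
  let f : Option (Fin n) → Rˣ := fun o => o.elim (-1) y
  have hf : ∀ r ∈ {w | SolGroupRel M c w}, FreeGroup.lift f r = 1 := by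
    rintro r (i | ⟨i, j, k, hi, hj⟩ | k | _ | i | hb)
    · ext; simp [f, y, sq, h.sq_eq]
    · have hij : y i * y j = y j * y i := Units.ext (h.comm k i j hi hj)
      simp [f, hij]
    · have hk : rowProd M y k = (-1) ^ (c k).val := by
        ext
        have := map_rowProd (M := M) (Units.coeHom R) y k
        simp only [Units.coeHom_apply] at this
        rw [this, Units.val_pow_eq_pow_val, Units.val_neg, Units.val_one]
        exact h.eqn k
      rw [map_mul, map_rowProd]
      simp [f, hk]
    · simp [f]
    · simp [f]
    · exact absurd hb hc
  intro hg
  have h1 : PresentedGroup.toGroup hf (SolGroup.gamma M c) = -1 := PresentedGroup.toGroup.of hf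
  rw [hg, map_one] at h1
  exact hR (by simpa using (congrArg Units.val h1).symm)

theorem solGroup_gen_sq {c : Fin m → ZMod 2} (i : Fin n) :
    (PresentedGroup.of (some i) : SolGroup M c) * PresentedGroup.of (some i) = 1 := by
  have h := PresentedGroup.one_of_mem (rels := {w | SolGroupRel M c w}) (.sq i)
  rwa [map_pow, sq] at h

theorem solGroup_gen_comm {c : Fin m → ZMod 2} {k : Fin m} {i j : Fin n}
    (hi : M k i = 1) (hj : M k j = 1) :
    (PresentedGroup.of (some i) : SolGroup M c) * PresentedGroup.of (some j) =
      PresentedGroup.of (some j) * PresentedGroup.of (some i) := by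
  have h := PresentedGroup.one_of_mem (rels := {w | SolGroupRel M c w}) (.comm i j k hi hj)
  rw [map_mul, map_mul, map_mul, map_inv, map_inv] at h
  rwa [mul_inv_eq_one, mul_inv_eq_iff_eq_mul] at h

theorem solGroup_rowProd {c : Fin m → ZMod 2} (k : Fin m) :
    rowProd M (fun i => (PresentedGroup.of (some i) : SolGroup M c)) k =
      SolGroup.gamma M c ^ (c k).val := by
  have h := PresentedGroup.one_of_mem (rels := {w | SolGroupRel M c w}) (.eqn k)
  rw [map_mul, map_inv, map_pow, map_rowProd, mul_inv_eq_one] at h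
  exact h

theorem solGroup_gamma_sq {c : Fin m → ZMod 2} :
    SolGroup.gamma M c * SolGroup.gamma M c = 1 := by
  have h := PresentedGroup.one_of_mem (rels := {w | SolGroupRel M c w}) .gamma_sq
  rwa [map_pow, sq] at h

theorem solGroup_gamma_central {c : Fin m → ZMod 2} (g : SolGroup M c) :
    g * SolGroup.gamma M c = SolGroup.gamma M c * g := by
  have hg : g ∈ Subgroup.centralizer {SolGroup.gamma M c} := by
    refine PresentedGroup.generated_by _ _ (fun o => ?_) g
    rw [Subgroup.mem_centralizer_singleton_iff]
    cases o with
    | none => rfl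
    | some i =>
      have h := PresentedGroup.one_of_mem (rels := {w | SolGroupRel M c w}) (.gamma_comm i)
      rw [map_mul, map_mul, map_mul, map_inv, map_inv] at h
      rwa [mul_inv_eq_one, mul_inv_eq_iff_eq_mul] at h
  exact Subgroup.mem_centralizer_singleton_iff.1 hg

end Relations

/-! ### Vertices as sign patterns, and the winning condition in terms of signs. -/

section Signs

variable {m n : ℕ} {M : Matrix (Fin m) (Fin n) (ZMod 2)} {b b' : Fin m → ZMod 2}

/-- The function `α` of a vertex `(k, α)`, extended by `1` to all indices. -/
def sgn (v : SolVertex M b) (i : Fin n) : ℤˣ :=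
  if h : i ∈ supp M v.1 then v.2.1 ⟨i, h⟩ else 1

theorem sgn_of_mem (v : SolVertex M b) {i : Fin n} (h : i ∈ supp M v.1) :
    sgn v i = v.2.1 ⟨i, h⟩ := dif_pos h

theorem prod_sgn (v : SolVertex M b) : ∏ i ∈ supp M v.1, sgn v i = (-1) ^ (b v.1).val := by
  rw [← v.2.2, ← Finset.prod_coe_sort]
  exact Finset.prod_congr rfl fun i _ => sgn_of_mem v i.2

theorem vertex_ext {v w : SolVertex M b} (h1 : v.1 = w.1)
    (h2 : ∀ i ∈ supp M v.1, sgn v i = sgn w i) : v = w := by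
  obtain ⟨k, α, hα⟩ := v
  obtain ⟨l, β, hβ⟩ := w
  obtain rfl : k = l := h1
  have : α = β := by
    funext i
    have := h2 i i.2
    rwa [sgn_of_mem _ i.2, sgn_of_mem _ i.2] at this
  subst this
  rfl

theorem exists_vertex {k : Fin m} (ε : Fin n → ℤˣ)
    (h : ∏ i ∈ supp M k, ε i = (-1) ^ (b k).val) :
    ∃ v : SolVertex M b, v.1 = k ∧ ∀ i ∈ supp M k, sgn v i = ε i := by
  refine ⟨⟨k, fun i => ε i, ?_⟩, rfl, fun i hi => sgn_of_mem _ hi⟩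
  rw [← h, Finset.prod_coe_sort]

/-- The whole required sign can be placed on one coordinate. Hence only an empty row with right-hand
side `1` has no vertices. -/
theorem exists_vertex_of_ne_empty {k : Fin m} {i : Fin n} (hi : i ∈ supp M k) :
    ∃ v : SolVertex M b, v.1 = k := by
  obtain ⟨v, hv, -⟩ := exists_vertex (M := M) (b := b) (k := k)
    (Pi.mulSingle i ((-1 : ℤˣ) ^ (b k).val)) (by rw [Finset.prod_pi_mulSingle', if_pos hi])
  exact ⟨v, hv⟩

theorem exists_vertex_of_eq_zero {k : Fin m} (hk : b k = 0) : ∃ v : SolVertex M b, v.1 = k := by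
  obtain ⟨v, hv, -⟩ := exists_vertex (M := M) (b := b) (k := k) 1 (by simp [hk])
  exact ⟨v, hv⟩

theorem triangle_eq_iff {v w : SolVertex M b} {v' w' : SolVertex M b'} (hv : v.1 = v'.1)
    (hw : w.1 = w'.1) :
    triangle v.2.1 w.2.1 = triangle v'.2.1 w'.2.1 ↔
      ∀ i ∈ supp M v.1 ∩ supp M w.1, sgn v i * sgn w i = sgn v' i * sgn w' i := by
  obtain ⟨k, α, hα⟩ := v
  obtain ⟨l, β, hβ⟩ := w
  obtain ⟨k', α', hα'⟩ := v'
  obtain ⟨l', β', hβ'⟩ := w'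
  obtain rfl : k = k' := hv
  obtain rfl : l = l' := hw
  simp only [triangle, Sigma.mk.injEq, heq_eq_eq, true_and]
  constructor
  · intro h i hi
    have hik := (Finset.mem_inter.1 hi).1
    have hil := (Finset.mem_inter.1 hi).2
    rw [sgn_of_mem ⟨k, α, hα⟩ hik, sgn_of_mem ⟨l, β, hβ⟩ hil, sgn_of_mem ⟨k, α', hα'⟩ hik,
      sgn_of_mem ⟨l, β', hβ'⟩ hil]
    exact congrFun h ⟨i, hi⟩
  · intro h
    funext i
    have hik := (Finset.mem_inter.1 i.2).1
    have hil := (Finset.mem_inter.1 i.2).2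
    have := h i i.2
    rwa [sgn_of_mem ⟨k, α, hα⟩ hik, sgn_of_mem ⟨l, β, hβ⟩ hil, sgn_of_mem ⟨k, α', hα'⟩ hik,
      sgn_of_mem ⟨l, β', hβ'⟩ hil] at this

theorem solGraph_isEdge_iff {s : SolColor m n} {v w : SolVertex M b} :
    (solGraph M b).IsEdge s v w ↔
      (v ≠ w ∧ (supp M v.1 ∩ supp M w.1).Nonempty) ∧ .inr (triangle v.2.1 w.2.1) = s := by
  unfold ColoredGraph.IsEdge
  rw [SimpleGraph.EdgeLabeling.labelGraph_adj]
  exact ⟨fun ⟨h, hs⟩ => ⟨h, hs⟩, fun ⟨h, hs⟩ => ⟨h, hs⟩⟩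

/-- The vertices `g, g'` and `h, h'` satisfy the winning condition of the isomorphism game. -/
def Compatible (g : SolVertex M b) (g' : SolVertex M b') (h : SolVertex M b)
    (h' : SolVertex M b') : Prop :=
  g.1 = g'.1 ∧ h.1 = h'.1 ∧
    ∀ i ∈ supp M g.1 ∩ supp M h.1, sgn g i * sgn g' i = sgn h i * sgn h' i

theorem units_swap {a b c d : ℤˣ} : a * b = c * d ↔ a * c = b * d := by
  revert a b c d; decide

/-- Once the rows match, one pointwise sign identity encodes both remaining rules. Swapping factors
turns it into equality of edge colors; if `g = h` or `g' = h'`, cancellation on the full row gives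
the other equality. -/
theorem compatible_iff {g : SolVertex M b} {g' : SolVertex M b'} {h : SolVertex M b}
    {h' : SolVertex M b'} :
    Compatible g g' h h' ↔
      ((solGraph M b).vertexColor g = (solGraph M b').vertexColor g' ∧
        (solGraph M b).vertexColor h = (solGraph M b').vertexColor h') ∧
      (g = h ↔ g' = h') ∧
      ∀ s, (solGraph M b).IsEdge s g h ↔ (solGraph M b').IsEdge s g' h' := by
  have hcol (v : SolVertex M b) (v' : SolVertex M b') :
      (solGraph M b).vertexColor v = (solGraph M b').vertexColor v' ↔ v.1 = v'.1 :=
    Sum.inl_injective.eq_iff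
  simp only [hcol, solGraph_isEdge_iff]
  constructor
  · rintro ⟨hg, hh, H⟩
    have heq : g = h ↔ g' = h' := by
      constructor
      · rintro rfl
        refine vertex_ext (hg.symm.trans hh) fun i hi => ?_
        have := H i (by rw [Finset.inter_self, hg]; exact hi)
        exact mul_left_cancel this
      · rintro rfl
        refine vertex_ext (hg.trans hh.symm) fun i hi => ?_
        have := H i (by rw [hh, ← hg, Finset.inter_self]; exact hi)
        exact mul_right_cancel this
    refine ⟨⟨hg, hh⟩, heq, fun s => ?_⟩
    rw [(triangle_eq_iff hg hh).2 fun i hi => units_swap.1 (H i hi), hg, hh, Ne, Ne, heq]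
  · rintro ⟨⟨hg, hh⟩, heq, H⟩
    refine ⟨hg, hh, fun i hi => ?_⟩
    by_cases hgh : g = h
    · rw [hgh, heq.1 hgh]
    · have := ((H _).1 ⟨⟨hgh, ⟨i, hi⟩⟩, rfl⟩).2
      exact units_swap.1 ((triangle_eq_iff hg hh).1 (Sum.inr_injective this).symm i hi)

theorem isoGameWin_iff {xA xB yA yB : SolVertex M b ⊕ SolVertex M b'} :
    IsoGameWin (solGraph M b) (solGraph M b') xA xB yA yB ↔
      ∃ gA gB gA' gB', Pairs xA yA gA gA' ∧ Pairs xB yB gB gB' ∧ Compatible gA gA' gB gB' := by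
  simp only [IsoGameWin, compatible_iff]

end Signs

/-! ### Perfect strategies and the operator algebra they generate. -/

section PerfectStrategy

theorem apply_eq_zero_of_re_inner_eq_zero {H : Type*} [NormedAddCommGroup H]
    [InnerProductSpace ℂ H] [CompleteSpace H] {T : H →L[ℂ] H} (hT : 0 ≤ T) {φ : H}
    (h : (Inner.inner ℂ φ (T φ)).re = 0) : T φ = 0 := by
  obtain ⟨S, rfl⟩ := CStarAlgebra.nonneg_iff_eq_star_mul_self.1 hT
  have h2 : (Inner.inner ℂ φ ((star S * S) φ)).re = ‖S φ‖ ^ 2 := by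
    rw [mul_apply_eq_comp, ContinuousLinearMap.star_eq_adjoint,
      ContinuousLinearMap.adjoint_inner_right]
    exact inner_self_eq_norm_sq (𝕜 := ℂ) (S φ)
  rw [h2, sq_eq_zero_iff, norm_eq_zero] at h
  rw [mul_apply_eq_comp, h, map_zero]

variable {I O : Type*} [Fintype O] (σ : CommutingStrategy.{v} I O)

theorem CommutingStrategy.mul_nonneg (xA xB : I) (yA yB : O) :
    0 ≤ σ.alice xA yA * σ.bob xB yB :=
  Commute.mul_nonneg ((ContinuousLinearMap.nonneg_iff_isPositive _).2 (σ.alice_pos xA yA))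
    ((ContinuousLinearMap.nonneg_iff_isPositive _).2 (σ.bob_pos xB yB)) (σ.commute xA yA xB yB)

theorem CommutingStrategy.prob_nonneg (xA xB : I) (yA yB : O) : 0 ≤ σ.prob xA xB yA yB :=
  ((ContinuousLinearMap.nonneg_iff_isPositive _).1 (σ.mul_nonneg xA xB yA yB)).re_inner_nonneg_right
    σ.state

theorem CommutingStrategy.sum_prob (xA xB : I) : ∑ yA, ∑ yB, σ.prob xA xB yA yB = 1 := by
  have h : ∑ yA, ∑ yB, σ.alice xA yA (σ.bob xB yB σ.state) = σ.state := by
    simp_rw [← map_sum, ← sum_apply, σ.bob_sum, σ.alice_sum]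
    rfl
  simp_rw [CommutingStrategy.prob, ← Complex.re_sum, ← inner_sum, h]
  have := inner_self_eq_norm_sq (𝕜 := ℂ) σ.state
  rw [σ.norm_state, one_pow] at this
  exact this

variable {σ} {win : I → I → O → O → Prop}

/-- The probabilities are nonnegative and sum to `1`, so each losing one is zero. Since `A B ≥ 0`,
`⟨ψ, A B ψ⟩ = 0` then improves to `A B ψ = 0`. -/
theorem CommutingStrategy.isPerfect_iff :
    σ.IsPerfect win ↔ ∀ xA xB yA yB, ¬ win xA xB yA yB →
      σ.alice xA yA (σ.bob xB yB σ.state) = 0 := by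
  classical
  constructor
  · intro h xA xB yA yB hlose
    refine apply_eq_zero_of_re_inner_eq_zero (σ.mul_nonneg xA xB yA yB) ?_
    have h1 := h xA xB
    rw [← σ.sum_prob xA xB] at h1
    have h2 := (Finset.sum_eq_sum_iff_of_le fun a _ => Finset.sum_le_sum fun c _ => by
      split_ifs
      · exact le_rfl
      · exact σ.prob_nonneg xA xB a c).1 h1 yA (Finset.mem_univ _)
    have h3 := (Finset.sum_eq_sum_iff_of_le fun c _ => by
      split_ifs
      · exact le_rfl
      · exact σ.prob_nonneg xA xB yA c).1 h2 yB (Finset.mem_univ _)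
    rw [if_neg hlose] at h3
    exact h3.symm
  · intro h xA xB
    rw [← σ.sum_prob xA xB]
    refine Finset.sum_congr rfl fun yA _ => Finset.sum_congr rfl fun yB _ => ?_
    split_ifs with hw
    · rfl
    · rw [CommutingStrategy.prob, h _ _ _ _ hw, inner_zero_right, Complex.zero_re]

/-- The span of all vectors obtained from the state by Bob's operators. -/
noncomputable def CommutingStrategy.cyclic (σ : CommutingStrategy.{v} I O) : Submodule ℂ σ.H :=
  (Subalgebra.toSubmodule (Algebra.adjoin ℂ {T | ∃ x y, σ.bob x y = T})).map
    ((ContinuousLinearMap.apply ℂ σ.H σ.state : (σ.H →L[ℂ] σ.H) →L[ℂ] σ.H) :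
      (σ.H →L[ℂ] σ.H) →ₗ[ℂ] σ.H)

theorem CommutingStrategy.mem_cyclic {φ : σ.H} :
    φ ∈ σ.cyclic ↔ ∃ T ∈ Algebra.adjoin ℂ {T | ∃ x y, σ.bob x y = T}, T σ.state = φ :=
  Iff.rfl

theorem CommutingStrategy.commute_adjoin (x : I) (y : O) {T : σ.H →L[ℂ] σ.H}
    (hT : T ∈ Algebra.adjoin ℂ {T | ∃ x y, σ.bob x y = T}) (φ : σ.H) :
    σ.alice x y (T φ) = T (σ.alice x y φ) := by
  have h : Algebra.adjoin ℂ {T | ∃ x y, σ.bob x y = T} ≤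
      Subalgebra.centralizer ℂ {σ.alice x y} := by
    refine Algebra.adjoin_le ?_
    rintro _ ⟨x', y', rfl⟩
    rw [SetLike.mem_coe, Subalgebra.mem_centralizer_iff]
    rintro _ rfl
    exact σ.commute x y x' y'
  have := (Subalgebra.mem_centralizer_iff ℂ).1 (h hT) _ rfl
  exact congrArg (fun S : σ.H →L[ℂ] σ.H => S φ) this

/-- In a perfect strategy for a synchronous game, Alice's operators give rise to projections in a
nontrivial ring which are orthogonal whenever the corresponding answers lose the game. -/
theorem CommutingStrategy.IsPerfect.exists_ring (hσ : σ.IsPerfect win)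
    (hwin : ∀ x y y', win x x y y' → y = y') :
    ∃ (R : Type v) (_ : Ring R) (_ : Algebra ℂ R) (_ : Nontrivial R) (E : I → O → R),
      (∀ x, ∑ y, E x y = 1) ∧
      ∀ x x' y y', ¬ win x x' y y' → E x y * E x' y' = 0 := by
  classical
  have h0 := CommutingStrategy.isPerfect_iff.1 hσ
  have hne : σ.state ≠ 0 := fun h => by simpa [h] using σ.norm_state
  -- Insert Bob's, respectively Alice's, resolution of the identity: unequal answers to equal
  -- questions lose, so both sides reduce to `A B ψ`.
  have hAB (x : I) (y : O) : σ.alice x y σ.state = σ.bob x y σ.state := by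
    have h1 : σ.alice x y σ.state = σ.alice x y (σ.bob x y σ.state) := by
      conv_lhs => rw [← one_apply_eq_self (F := σ.H →L[ℂ] σ.H) σ.state,
        ← σ.bob_sum x, sum_apply, map_sum]
      refine Finset.sum_eq_single y (fun y' _ hy => ?_) (by simp)
      exact h0 _ _ _ _ fun hw => hy (hwin _ _ _ hw).symm
    have h2 : σ.bob x y σ.state = σ.alice x y (σ.bob x y σ.state) := by
      conv_lhs => rw [← one_apply_eq_self (F := σ.H →L[ℂ] σ.H) (σ.bob x y σ.state),
        ← σ.alice_sum x, sum_apply]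
      refine Finset.sum_eq_single y (fun y' _ hy => ?_) (by simp)
      exact h0 _ _ _ _ fun hw => hy (hwin _ _ _ hw)
    rw [h1, ← h2]
  have hmem (x : I) (y : O) (φ : σ.H) (hφ : φ ∈ σ.cyclic) : σ.alice x y φ ∈ σ.cyclic := by
    obtain ⟨T, hT, rfl⟩ := CommutingStrategy.mem_cyclic.1 hφ
    rw [CommutingStrategy.commute_adjoin x y hT, hAB]
    exact CommutingStrategy.mem_cyclic.2
      ⟨T * σ.bob x y, mul_mem hT (Algebra.subset_adjoin ⟨x, y, rfl⟩), rfl⟩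
  have hst : σ.state ∈ σ.cyclic := CommutingStrategy.mem_cyclic.2 ⟨1, one_mem _, rfl⟩
  have : Nontrivial σ.cyclic := ⟨⟨⟨σ.state, hst⟩, 0, fun h => hne (congrArg Subtype.val h)⟩⟩
  -- Only a ring is needed, so the cyclic subspace is neither closed nor completed.
  refine ⟨Module.End ℂ σ.cyclic, inferInstance, inferInstance, inferInstance,
    fun x y => (σ.alice x y : σ.H →ₗ[ℂ] σ.H).restrict (hmem x y), fun x => ?_, ?_⟩
  · ext φ
    have := congrArg (fun S : σ.H →L[ℂ] σ.H => S φ) (σ.alice_sum x)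
    simpa using this
  · intro x x' y y' hlose
    ext ⟨φ, hφ⟩
    obtain ⟨T, hT, rfl⟩ := CommutingStrategy.mem_cyclic.1 hφ
    change σ.alice x y (σ.alice x' y' (T σ.state)) = 0
    -- Both of Alice's operators move past `T`; the inner one becomes Bob's on the state, leaving `T
    -- (A B ψ) = 0`.
    rw [CommutingStrategy.commute_adjoin x' y' hT, CommutingStrategy.commute_adjoin x y hT, hAB,
      h0 _ _ _ _ hlose, map_zero]

end PerfectStrategy

/-! ### From a perfect strategy to a solution of the relations. -/

section Observables

variable {m n : ℕ} {M : Matrix (Fin m) (Fin n) (ZMod 2)} {b b' : Fin m → ZMod 2}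

theorem neg_one_pow_val_add (s t : ZMod 2) :
    (-1 : ℤˣ) ^ s.val * (-1) ^ t.val = (-1) ^ (s + t).val := by
  revert s t; decide

theorem eq_one_of_ne_zero {s : ZMod 2} (h : s ≠ 0) : s = 1 := by
  revert s; decide

theorem isoGameWin_self {x y y' : SolVertex M b ⊕ SolVertex M b'}
    (h : IsoGameWin (solGraph M b) (solGraph M b') x x y y') : y = y' := by
  obtain ⟨gA, gB, gA', gB', h1, h2, -, h3, -⟩ := h
  rcases h1 with ⟨rfl, rfl⟩ | ⟨rfl, rfl⟩ <;> rcases h2 with ⟨h2, rfl⟩ | ⟨h2, rfl⟩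
  · rw [h3.1 (Sum.inl_injective h2)]
  · cases h2
  · cases h2
  · rw [h3.2 (Sum.inr_injective h2)]

variable {R : Type*} [Ring R]

/-- A family `F g g'` of elements of a ring, indexed by the vertices of `G(M,b)` and `G(M,b')`,
with `∑_{g'} F g g' = 1` and vanishing products for incompatible pairs. -/
structure MagicFamily (F : SolVertex M b → SolVertex M b' → R) : Prop where
  sum_eq : ∀ g, ∑ g', F g g' = 1
  mul_eq : ∀ g g' h h', ¬ Compatible g g' h h' → F g g' * F h h' = 0

/-- The observable for the variable `i` obtained from the question `g`. -/
def observable (F : SolVertex M b → SolVertex M b' → R) (g : SolVertex M b) (i : Fin n) : R :=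
  ∑ g', (sgn g i * sgn g' i) • F g g'

namespace MagicFamily

variable {F : SolVertex M b → SolVertex M b' → R} (hF : MagicFamily F)
include hF

theorem mul_self (g : SolVertex M b) (g' : SolVertex M b') : F g g' * F g g' = F g g' := by
  conv_rhs => rw [← mul_one (F g g'), ← hF.sum_eq g, Finset.mul_sum]
  exact (Finset.sum_eq_single_of_mem g' (Finset.mem_univ _) fun h' _ hne =>
    hF.mul_eq g g' g h' fun hc => hne ((compatible_iff.1 hc).2.1.1 rfl).symm).symm

theorem mul_of_ne (g : SolVertex M b) {g' h' : SolVertex M b'} (hne : g' ≠ h') :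
    F g g' * F g h' = 0 :=
  hF.mul_eq _ _ _ _ fun hc => hne ((compatible_iff.1 hc).2.1.1 rfl)

theorem eq_zero {g : SolVertex M b} {g' : SolVertex M b'} (h : g.1 ≠ g'.1) : F g g' = 0 := by
  rw [← hF.mul_self]
  exact hF.mul_eq _ _ _ _ fun hc => h hc.1

/-- For fixed `g` the `F g g'` are orthogonal idempotents, so coefficients multiply pointwise. -/
theorem sum_smul_mul_sum_smul (g : SolVertex M b) (ε δ : SolVertex M b' → ℤˣ) :
    (∑ g', ε g' • F g g') * ∑ g', δ g' • F g g' = ∑ g', (ε g' * δ g') • F g g' := by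
  rw [Finset.sum_mul_sum]
  refine Finset.sum_congr rfl fun g' _ => ?_
  rw [Finset.sum_eq_single g' (fun h' _ hne => ?_) (by simp), smul_mul_smul_comm, hF.mul_self]
  rw [smul_mul_smul_comm, hF.mul_of_ne g hne.symm, smul_zero]

/-- Compatible pairs have the same sign at `i`, so the signs cancel; incompatible products vanish.
What remains is the product of two resolutions of the identity. With `g = h` this also shows that
observables are involutions. -/
theorem observable_mul {g h : SolVertex M b} {i : Fin n} (hg : i ∈ supp M g.1)
    (hh : i ∈ supp M h.1) : observable F g i * observable F h i = 1 := by
  have h1 : (∑ g', F g g') * ∑ h', F h h' = 1 := by rw [hF.sum_eq, hF.sum_eq, one_mul]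
  rw [← h1, observable, observable, Finset.sum_mul_sum, Finset.sum_mul_sum]
  refine Finset.sum_congr rfl fun g' _ => Finset.sum_congr rfl fun h' _ => ?_
  by_cases hc : Compatible g g' h h'
  · rw [smul_mul_smul_comm, hc.2.2 i (Finset.mem_inter.2 ⟨hg, hh⟩), Int.units_mul_self, one_smul]
  · rw [smul_mul_smul_comm, hF.mul_eq _ _ _ _ hc, smul_zero]

theorem observable_eq {g h : SolVertex M b} {i : Fin n} (hg : i ∈ supp M g.1)
    (hh : i ∈ supp M h.1) : observable F g i = observable F h i := by
  calc observable F g i = observable F g i * (observable F g i * observable F h i) := by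
        rw [hF.observable_mul hg hh, mul_one]
    _ = observable F h i := by rw [← mul_assoc, hF.observable_mul hg hg, one_mul]

theorem observable_comm (g : SolVertex M b) (i j : Fin n) :
    observable F g i * observable F g j = observable F g j * observable F g i := by
  unfold observable
  rw [hF.sum_smul_mul_sum_smul, hF.sum_smul_mul_sum_smul]
  simp_rw [mul_comm]

/-- Only `g'` in the row of `g` contribute, and for these the sign products are prescribed by `b`
and `b'`. -/
theorem rowProd_observable (g : SolVertex M b) :
    rowProd M (observable F g) g.1 = (-1) ^ ((b + b') g.1).val := by
  have h1 (l : List (Fin n)) : (l.map (observable F g)).prod =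
      ∑ g', (l.map fun i => sgn g i * sgn g' i).prod • F g g' := by
    induction l with
    | nil => simp [hF.sum_eq]
    | cons i l ih =>
      rw [List.map_cons, List.prod_cons, ih, observable, hF.sum_smul_mul_sum_smul]
      simp
  have h2 (g' : SolVertex M b') : rowProd M (fun i => sgn g i * sgn g' i) g.1 • F g g' =
      ((-1 : ℤˣ) ^ ((b + b') g.1).val) • F g g' := by
    by_cases hg : g.1 = g'.1
    · have h3 := prod_sgn g'
      rw [← hg] at h3
      rw [rowProd_eq_prod, Finset.prod_mul_distrib, prod_sgn g, h3, neg_one_pow_val_add]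
      rfl
    · rw [hF.eq_zero hg, smul_zero, smul_zero]
  have h3 : rowProd M (observable F g) g.1 =
      ∑ g', rowProd M (fun i => sgn g i * sgn g' i) g.1 • F g g' := h1 _
  rw [h3, Finset.sum_congr rfl fun g' _ => h2 g', ← Finset.smul_sum, hF.sum_eq, Units.smul_def]
  simp

/-- The observables of a magic family satisfy the relations of the solution group, provided that
no empty row has right-hand side `1` in the first system and `0` in the second. -/
theorem exists_ringRel (hrow : ∀ k, b k = 1 → b' k = 0 → ∃ i, i ∈ supp M k) :
    ∃ x : Fin n → R, RingRel M (b + b') x := by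
  classical
  let x : Fin n → R := fun i =>
    -- A variable in no row that has vertices gets the value `1`. It lies in no row at all, because
    -- nonempty rows have vertices.
    if h : ∃ g : SolVertex M b, i ∈ supp M g.1 then observable F h.choose i else 1
  have hx (g : SolVertex M b) {i : Fin n} (hi : i ∈ supp M g.1) : x i = observable F g i := by
    have h : ∃ g : SolVertex M b, i ∈ supp M g.1 := ⟨g, hi⟩
    simp only [x, dif_pos h]
    exact hF.observable_eq h.choose_spec hi
  refine ⟨x, fun i => ?_, fun k i j hi hj => ?_, fun k => ?_⟩
  · by_cases h : ∃ g : SolVertex M b, i ∈ supp M g.1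
    · obtain ⟨g, hg⟩ := h
      rw [hx g hg, hF.observable_mul hg hg]
    · simp only [x, dif_neg h, mul_one]
  · rw [← mem_supp] at hi hj
    obtain ⟨g, rfl⟩ := exists_vertex_of_ne_empty (b := b) hi
    rw [hx g hi, hx g hj, hF.observable_comm]
  · by_cases h : ∃ g : SolVertex M b, g.1 = k
    · obtain ⟨g, rfl⟩ := h
      rw [← hF.rowProd_observable g]
      exact rowProd_congr fun i hi => hx g (mem_supp.2 hi)
    · have hempty : ∀ i, i ∉ supp M k := fun i hi => h (exists_vertex_of_ne_empty hi)
      have hb : b k = 1 := eq_one_of_ne_zero fun h0 => h (exists_vertex_of_eq_zero h0)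
      have hb' : b' k = 1 := eq_one_of_ne_zero fun h0 =>
        (hrow k hb h0).elim fun i hi => hempty i hi
      have hc : (b + b') k = 0 := by rw [Pi.add_apply, hb, hb']; decide
      rw [hc, ZMod.val_zero, pow_zero]
      rw [rowProd, List.filter_eq_nil_iff.2, List.map_nil, List.prod_nil]
      intro i _
      simpa [mem_supp] using hempty i

end MagicFamily

theorem QuantumIsomorphic.gamma_ne_one (hb : b ≠ b')
    (h : QuantumIsomorphic.{v} (solGraph M b) (solGraph M b')) :
    SolGroup.gamma M (b + b') ≠ 1 := by
  classical
  obtain ⟨σ, hσ⟩ := h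
  obtain ⟨R, _, _, _, E, hsum, hmul⟩ := hσ.exists_ring fun x y y' => isoGameWin_self
  have hidem (x y) (h : E x y * E x y = 0) : E x y = 0 := by
    rw [← mul_one (E x y), ← hsum x, Finset.mul_sum]
    refine Finset.sum_eq_zero fun y' _ => ?_
    by_cases hy : y = y'
    · rw [← hy, h]
    · exact hmul _ _ _ _ fun hw => hy (isoGameWin_self hw)
  have hzero (x y) (h : ¬ IsoGameWin (solGraph M b) (solGraph M b') x x y y) : E x y = 0 :=
    hidem _ _ (hmul _ _ _ _ h)
  have hF : MagicFamily fun (g : SolVertex M b) (g' : SolVertex M b') => E (.inl g) (.inr g') := by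
    refine ⟨fun g => ?_, fun g g' h h' hc => hmul _ _ _ _ fun hw => hc ?_⟩
    · rw [← hsum (.inl g), Fintype.sum_sum_type, right_eq_add]
      refine Finset.sum_eq_zero fun y _ => ?_
      refine hzero _ _ fun hw => ?_
      obtain ⟨_, _, _, _, h1, -⟩ := isoGameWin_iff.1 hw
      rcases h1 with ⟨-, h1⟩ | ⟨h1, -⟩ <;> cases h1
    · obtain ⟨_, _, _, _, h1, h2, h3⟩ := isoGameWin_iff.1 hw
      rcases h1 with ⟨h1, h1'⟩ | ⟨h1, -⟩
      · rcases h2 with ⟨h2, h2'⟩ | ⟨h2, -⟩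
        · cases h1; cases h1'; cases h2; cases h2'; exact h3
        · cases h2
      · cases h1
  -- On such an empty row the second graph has a vertex of color `k` and the first has none. Every
  -- answer to that vertex loses, so the identity would be a sum of zeros.
  have hrow (k) (hk : b k = 1) (hk' : b' k = 0) : ∃ i, i ∈ supp M k := by
    by_contra! hempty
    obtain ⟨g', rfl⟩ := exists_vertex_of_eq_zero (M := M) hk'
    refine one_ne_zero (α := R) ?_
    rw [← hsum (.inr g')]
    refine Finset.sum_eq_zero fun y _ => hzero _ _ fun hw => ?_
    obtain ⟨g, _, _, _, h1, -, h3⟩ := isoGameWin_iff.1 hw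
    rcases h1 with ⟨h1, -⟩ | ⟨h1, -⟩
    · cases h1
    · cases h1
      have h4 := prod_sgn g
      rw [h3.1, Finset.eq_empty_of_forall_notMem hempty, hk,
        Finset.prod_empty] at h4
      exact absurd h4 (by decide)
  obtain ⟨x, hx⟩ := hF.exists_ringRel hrow
  refine hx.gamma_ne_one (fun h0 => hb ?_) fun h => ?_
  · funext k
    have := congrFun h0 k
    rw [Pi.add_apply] at this
    exact CharTwo.add_eq_zero.1 this
  · have h2 : algebraMap ℂ R (-1) = algebraMap ℂ R 1 := by simpa using h
    have := (algebraMap ℂ R).injective h2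
    norm_num at this

end Observables

/-! ### Left and right translations on the antisymmetric part of `ℓ²` of a group. -/

section Regular

theorem memℓp_comp_equiv {ι : Type*} (e : Equiv.Perm ι) {f : ι → ℂ} (hf : Memℓp f 2) :
    Memℓp (f ∘ e) 2 := by
  rw [memℓp_gen_iff (by norm_num)] at hf ⊢
  exact e.summable_iff.2 hf

/-- Composition with a permutation, as an isometry of `ℓ²`. -/
noncomputable def l2Perm {ι : Type*} (e : Equiv.Perm ι) :
    lp (fun _ : ι => ℂ) 2 →L[ℂ] lp (fun _ : ι => ℂ) 2 :=
  LinearIsometry.toContinuousLinearMap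
    { toFun := fun f => ⟨f ∘ e, memℓp_comp_equiv e f.2⟩
      map_add' := fun _ _ => rfl
      map_smul' := fun _ _ => rfl
      norm_map' := fun f => by
        rw [lp.norm_eq_tsum_rpow (by norm_num), lp.norm_eq_tsum_rpow (by norm_num)]
        congr 1
        exact e.tsum_eq fun i => ‖f i‖ ^ (2 : ℝ≥0∞).toReal }

theorem l2Perm_apply {ι : Type*} (e : Equiv.Perm ι) (f : lp (fun _ : ι => ℂ) 2) (i : ι) :
    l2Perm e f i = f (e i) := rfl

theorem inner_l2Perm {ι : Type*} (e : Equiv.Perm ι) (f g : lp (fun _ : ι => ℂ) 2) :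
    Inner.inner ℂ (l2Perm e f) g = Inner.inner ℂ f (l2Perm e⁻¹ g) := by
  rw [lp.inner_eq_tsum, lp.inner_eq_tsum, ← e.tsum_eq fun i => Inner.inner ℂ (f i) (l2Perm e⁻¹ g i)]
  refine tsum_congr fun i => ?_
  rw [l2Perm_apply, l2Perm_apply, show e⁻¹ (e i) = i from e.symm_apply_apply i]

variable {G : Type} [Group G]

/-- Left translation on `ULift G`. -/
def leftPerm (g : G) : Equiv.Perm (ULift.{v} G) :=
  Equiv.ulift.trans ((Equiv.mulLeft g).trans Equiv.ulift.symm)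

/-- Right translation on `ULift G`. -/
def rightPerm (g : G) : Equiv.Perm (ULift.{v} G) :=
  Equiv.ulift.trans ((Equiv.mulRight g).trans Equiv.ulift.symm)

/-- The subspace of `ℓ²(G)` on which `z` acts as `-1`. -/
noncomputable def antiSpace (z : G) : Submodule ℂ (lp (fun _ : ULift.{v} G => ℂ) 2) :=
  (l2Perm (leftPerm z) + 1).ker

theorem mem_antiSpace {z : G} {f : lp (fun _ : ULift.{v} G => ℂ) 2} :
    f ∈ antiSpace z ↔ ∀ h : G, f ⟨z * h⟩ = - f ⟨h⟩ := by
  rw [antiSpace, LinearMap.mem_ker]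
  constructor
  · intro hf h
    have := congrArg (fun f : lp (fun _ : ULift.{v} G => ℂ) 2 => f ⟨h⟩) hf
    exact eq_neg_of_add_eq_zero_left this
  · intro hf
    ext h
    exact add_eq_zero_iff_eq_neg.2 (hf h.down)

instance completeSpace_antiSpace (z : G) : CompleteSpace (antiSpace.{v} z) :=
  inferInstanceAs (CompleteSpace (l2Perm (leftPerm z) + 1).ker)

/-- The restriction to the antisymmetric subspace of a permutation operator preserving it. -/
noncomputable def antiPerm {z : G} (e : Equiv.Perm (ULift.{v} G))
    (he : ∀ h : G, (e ⟨z * h⟩).down = z * (e ⟨h⟩).down) :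
    antiSpace.{v} z →L[ℂ] antiSpace.{v} z :=
  ((l2Perm e).comp (antiSpace.{v} z).subtypeL).codRestrict (antiSpace z) fun f =>
    mem_antiSpace.2 fun h => by
      have := mem_antiSpace.1 f.2 (e ⟨h⟩).down
      rw [← he] at this
      exact this

theorem antiPerm_apply {z : G} {e : Equiv.Perm (ULift.{v} G)}
    {he : ∀ h : G, (e ⟨z * h⟩).down = z * (e ⟨h⟩).down} (f : antiSpace.{v} z) (i : ULift.{v} G) :
    (antiPerm e he f : lp (fun _ : ULift.{v} G => ℂ) 2) i =
      (f : lp (fun _ : ULift.{v} G => ℂ) 2) (e i) := rfl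

/-- A group with a central involution `z` acts on a nonzero Hilbert space by commuting unitary
left and right translations, in such a way that `z` acts as `-1`, and left and right translation
by an involution agree on a unit vector. -/
theorem exists_biregular_rep (z : G) (hz : ∀ g, g * z = z * g) (hzz : z * z = 1) (hz1 : z ≠ 1) :
    ∃ (H : Type v) (_ : NormedAddCommGroup H) (_ : InnerProductSpace ℂ H) (_ : CompleteSpace H)
      (L R : G →* (H →L[ℂ] H)) (ψ : H), ‖ψ‖ = 1 ∧ L z = -1 ∧ R z = -1 ∧
      (∀ g h, L g * R h = R h * L g) ∧ (∀ g, g * g = 1 → star (L g) = L g) ∧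
      (∀ g, g * g = 1 → star (R g) = R g) ∧ ∀ g, g * g = 1 → L g ψ = R g ψ := by
  classical
  -- Left translations preserve antisymmetry because `z` is central; right translations do so by
  -- associativity.
  have hL (g : G) (h : G) : (leftPerm.{v} g⁻¹ ⟨z * h⟩).down = z * (leftPerm.{v} g⁻¹ ⟨h⟩).down := by
    change g⁻¹ * (z * h) = z * (g⁻¹ * h)
    rw [← mul_assoc, hz, mul_assoc]
  have hR (g : G) (h : G) : (rightPerm.{v} g ⟨z * h⟩).down = z * (rightPerm.{v} g ⟨h⟩).down :=
    mul_assoc _ _ _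
  let L : G →* (antiSpace.{v} z →L[ℂ] antiSpace.{v} z) :=
    { toFun := fun g => antiPerm (leftPerm g⁻¹) (hL g)
      map_one' := by
        ext f i
        rw [antiPerm_apply]
        change (f : lp (fun _ : ULift.{v} G => ℂ) 2) ⟨1⁻¹ * i.down⟩ = _
        rw [inv_one, one_mul]; rfl
      map_mul' := fun g h => by
        ext f i
        rw [antiPerm_apply]
        change (f : lp (fun _ : ULift.{v} G => ℂ) 2) ⟨(g * h)⁻¹ * i.down⟩ =
          (f : lp (fun _ : ULift.{v} G => ℂ) 2) ⟨h⁻¹ * (g⁻¹ * i.down)⟩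
        rw [mul_inv_rev, mul_assoc] }
  let R : G →* (antiSpace.{v} z →L[ℂ] antiSpace.{v} z) :=
    { toFun := fun g => antiPerm (rightPerm g) (hR g)
      map_one' := by
        ext f i
        rw [antiPerm_apply]
        change (f : lp (fun _ : ULift.{v} G => ℂ) 2) ⟨i.down * 1⟩ = _
        rw [mul_one]; rfl
      map_mul' := fun g h => by
        ext f i
        rw [antiPerm_apply]
        change (f : lp (fun _ : ULift.{v} G => ℂ) 2) ⟨i.down * (g * h)⟩ =
          (f : lp (fun _ : ULift.{v} G => ℂ) 2) ⟨(i.down * g) * h⟩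
        rw [mul_assoc] }
  have hLa (g : G) (f : antiSpace.{v} z) (h : G) :
      (L g f : lp (fun _ : ULift.{v} G => ℂ) 2) ⟨h⟩ =
        (f : lp (fun _ : ULift.{v} G => ℂ) 2) ⟨g⁻¹ * h⟩ := rfl
  have hRa (g : G) (f : antiSpace.{v} z) (h : G) :
      (R g f : lp (fun _ : ULift.{v} G => ℂ) 2) ⟨h⟩ =
        (f : lp (fun _ : ULift.{v} G => ℂ) 2) ⟨h * g⟩ := rfl
  let δ : G → lp (fun _ : ULift.{v} G => ℂ) 2 := fun g => lp.single 2 ⟨g⟩ 1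
  have hδ (g h : G) : δ g ⟨h⟩ = if h = g then 1 else 0 := by
    simp [δ, lp.single_apply, Pi.single_apply, ULift.ext_iff]
  have hval (h : G) : (δ 1 - δ z) ⟨h⟩ = (if h = 1 then 1 else 0) - if h = z then 1 else 0 := by
    rw [← hδ, ← hδ]; rfl
  have hz' (h : G) : z * h = 1 ↔ h = z := by
    constructor
    · intro hh; rw [← mul_one z, ← hh, ← mul_assoc, hzz, one_mul]
    · rintro rfl; exact hzz
  -- Up to the factor `2`, this is the projection of `δ 1` to the antisymmetric subspace; it is
  -- nonzero because `z ≠ 1`.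
  have hφ : δ 1 - δ z ∈ antiSpace.{v} z := by
    refine mem_antiSpace.2 fun h => ?_
    rw [hval, hval, neg_sub]
    simp only [hz', mul_eq_left]
  let φ : antiSpace.{v} z := ⟨δ 1 - δ z, hφ⟩
  have hφ0 : φ ≠ 0 := by
    intro h0
    have h1 : (δ 1 - δ z) ⟨1⟩ = 0 := by
      rw [show δ 1 - δ z = 0 from congrArg Subtype.val h0]; rfl
    rw [hval, if_pos rfl, if_neg (Ne.symm hz1)] at h1
    norm_num at h1
  refine ⟨antiSpace.{v} z, inferInstance, inferInstance, inferInstance, L, R,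
    ((‖φ‖⁻¹ : ℝ) : ℂ) • φ, ?_, ?_, ?_, ?_, ?_, ?_, ?_⟩
  · rw [norm_smul, Complex.norm_real, norm_inv, norm_norm, inv_mul_cancel₀ (norm_ne_zero_iff.2 hφ0)]
  · ext f ⟨h⟩
    rw [hLa, inv_eq_of_mul_eq_one_left hzz, mem_antiSpace.1 f.2]
    rfl
  · ext f ⟨h⟩
    rw [hRa, hz, mem_antiSpace.1 f.2]
    rfl
  · intro g h
    ext f ⟨k⟩
    change (f : lp (fun _ : ULift.{v} G => ℂ) 2) ⟨(g⁻¹ * k) * h⟩ =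
      (f : lp (fun _ : ULift.{v} G => ℂ) 2) ⟨g⁻¹ * (k * h)⟩
    rw [mul_assoc]
  · intro g hg
    rw [ContinuousLinearMap.star_eq_adjoint]
    refine ((ContinuousLinearMap.eq_adjoint_iff _ _).2 fun f f' => ?_).symm
    have he : (leftPerm.{v} g⁻¹)⁻¹ = leftPerm.{v} g⁻¹ := by
      refine inv_eq_of_mul_eq_one_left (Equiv.ext fun i => ?_)
      change (⟨g⁻¹ * (g⁻¹ * i.down)⟩ : ULift.{v} G) = i
      rw [← mul_assoc, ← mul_inv_rev, hg, inv_one, one_mul]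
    have := inner_l2Perm (leftPerm.{v} g⁻¹) f.1 f'.1
    rw [he] at this
    exact this
  · intro g hg
    rw [ContinuousLinearMap.star_eq_adjoint]
    refine ((ContinuousLinearMap.eq_adjoint_iff _ _).2 fun f f' => ?_).symm
    have he : (rightPerm.{v} g)⁻¹ = rightPerm.{v} g := by
      refine inv_eq_of_mul_eq_one_left (Equiv.ext fun i => ?_)
      change (⟨i.down * g * g⟩ : ULift.{v} G) = i
      rw [mul_assoc, hg, mul_one]
    have := inner_l2Perm (rightPerm.{v} g) f.1 f'.1
    rw [he] at this
    exact this
  · intro g hg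
    rw [map_smul, map_smul]
    congr 1
    ext ⟨h⟩
    rw [hLa, hRa, inv_eq_of_mul_eq_one_left hg]
    change (δ 1 - δ z) ⟨g * h⟩ = (δ 1 - δ z) ⟨h * g⟩
    -- As `g⁻¹ = g`, the two translates are evaluated at `g * h` and `h * g`, which reach `1`, and
    -- by centrality also `z`, for the same `h`.
    have h1 : g * h = 1 ↔ h * g = 1 := mul_eq_one_iff_eq_inv'.trans mul_eq_one_iff_eq_inv.symm
    have h2 : g * h = z ↔ h * g = z := by
      rw [← eq_inv_mul_iff_mul_eq, ← eq_mul_inv_iff_mul_eq, hz]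
    simp only [hval, h1, h2]

end Regular

/-! ### Joint spectral projections for the variables of one row. -/

section Spectral

/-- Joint spectral projections of self-adjoint involutions in a commutative algebra. -/
noncomputable def jointProj {ι C : Type*} [CommRing C] [Algebra ℂ C] (S : Finset ι) (x : ι → C)
    (χ : ι → ℤˣ) : C :=
  ∏ i ∈ S, (2⁻¹ : ℂ) • (1 + χ i • x i)

section JointProj

variable {ι C : Type*} [CommRing C] [Algebra ℂ C] {S : Finset ι} {x : ι → C}

theorem half_smul_two (a : C) : (2⁻¹ : ℂ) • (2 * a) = a := by
  rw [two_mul, smul_add, ← add_smul]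
  norm_num

theorem jointProj_mul_self (hx : ∀ i ∈ S, x i * x i = 1) (χ : ι → ℤˣ) :
    jointProj S x χ * jointProj S x χ = jointProj S x χ := by
  rw [jointProj, ← Finset.prod_mul_distrib]
  refine Finset.prod_congr rfl fun i hi => ?_
  have h : (1 + χ i • x i) * (1 + χ i • x i) = 2 * (1 + χ i • x i) := by
    have : (χ i • x i) * (χ i • x i) = 1 := by
      rw [smul_mul_smul_comm, Int.units_mul_self, one_smul, hx i hi]
    linear_combination this
  rw [smul_mul_smul_comm, h, mul_smul, half_smul_two]

theorem star_jointProj [StarRing C] [StarModule ℂ C] (hx : ∀ i ∈ S, star (x i) = x i)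
    (χ : ι → ℤˣ) : star (jointProj S x χ) = jointProj S x χ := by
  rw [jointProj, star_prod]
  refine Finset.prod_congr rfl fun i hi => ?_
  rcases Int.units_eq_one_or (χ i) with h | h <;>
    simp [h, Units.smul_def, hx i hi]

theorem mul_jointProj (hx : ∀ i ∈ S, x i * x i = 1) (χ : ι → ℤˣ) {i : ι} (hi : i ∈ S) :
    x i * jointProj S x χ = χ i • jointProj S x χ := by
  classical
  rw [jointProj, ← Finset.mul_prod_erase S _ hi, ← mul_assoc, ← smul_mul_assoc]
  congr 1
  rw [mul_smul_comm, smul_comm]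
  congr 1
  rw [mul_add, mul_one, mul_smul_comm, hx i hi, smul_add, smul_smul, Int.units_mul_self, one_smul,
    add_comm]

/-- Expand the product over `i` of `½(1 + x i) + ½(1 - x i) = 1`. The value `1` outside `S` is never
read. -/
theorem sum_jointProj [DecidableEq ι] (S : Finset ι) (x : ι → C) :
    ∑ χ : S → ℤˣ, jointProj S x (fun i => if h : i ∈ S then χ ⟨i, h⟩ else 1) = 1 := by
  have h1 (χ : S → ℤˣ) : jointProj S x (fun i => if h : i ∈ S then χ ⟨i, h⟩ else 1) =
      ∏ i : S, (2⁻¹ : ℂ) • (1 + χ i • x i) := by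
    rw [jointProj, ← Finset.prod_coe_sort]
    refine Finset.prod_congr rfl fun i _ => ?_
    rw [dif_pos i.2]
  simp_rw [h1]
  rw [← Fintype.piFinset_univ, ← Finset.prod_univ_sum (fun _ => Finset.univ)
    fun (i : S) (s : ℤˣ) => (2⁻¹ : ℂ) • (1 + s • x i)]
  refine Finset.prod_eq_one fun i _ => ?_
  rw [← Finset.smul_sum]
  have : ∑ s : ℤˣ, (1 + s • x i) = 2 * 1 := by
    rw [show (Finset.univ : Finset ℤˣ) = {1, -1} from rfl, Finset.sum_pair (by decide)]
    rw [one_smul, Units.neg_smul, one_smul]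
    ring
  rw [this, half_smul_two]

end JointProj

variable {m n : ℕ} {M : Matrix (Fin m) (Fin n) (ZMod 2)} {c : Fin m → ZMod 2}
  {A : Type*} [Ring A] [StarRing A]

/-- A family of joint spectral projections `P k χ` of the elements `x_i`, `i ∈ S_k`. -/
structure SpectralFamily (M : Matrix (Fin m) (Fin n) (ZMod 2)) (c : Fin m → ZMod 2) (x : Fin n → A)
    (P : Fin m → (Fin n → ℤˣ) → A) : Prop where
  star_eq : ∀ k χ, star (P k χ) = P k χ
  mul_self : ∀ k χ, P k χ * P k χ = P k χ
  sum_eq : ∀ k, ∑ χ : supp M k → ℤˣ, P k (fun i => if h : i ∈ supp M k then χ ⟨i, h⟩ else 1) = 1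
  eigen : ∀ k χ, ∀ i ∈ supp M k, x i * P k χ = χ i • P k χ
  commute : ∀ k χ y, (∀ i, x i * y = y * x i) → P k χ * y = y * P k χ
  congr : ∀ k χ χ', (∀ i ∈ supp M k, χ i = χ' i) → P k χ = P k χ'
  eq_zero : ∀ k χ, ∏ i ∈ supp M k, χ i ≠ (-1) ^ (c k).val → P k χ = 0

theorem SpectralFamily.eigen_right {x : Fin n → A} {P : Fin m → (Fin n → ℤˣ) → A}
    (hP : SpectralFamily M c x P) (hstar : ∀ i, star (x i) = x i) {k : Fin m} (χ : Fin n → ℤˣ)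
    {i : Fin n} (hi : i ∈ supp M k) : P k χ * x i = χ i • P k χ := by
  have h := congrArg star (hP.eigen k χ i hi)
  rw [star_mul, hP.star_eq, hstar] at h
  rw [h]
  rcases Int.units_eq_one_or (χ i) with h' | h' <;> simp [h', Units.smul_def, hP.star_eq]

-- The variables of a row generate a commutative ⋆-subalgebra, where `jointProj` is available. On `P
-- k χ` the row product acts both as `∏ χ i` and as `(-1)^(c k)`; if these signs differ, `P k χ`
-- equals its own negative.
open scoped IsMulCommutative in
theorem RingRel.exists_spectralFamily [Algebra ℂ A] [StarModule ℂ A] {x : Fin n → A} (h : RingRel M c x)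
    (hstar : ∀ i, star (x i) = x i) : ∃ P, SpectralFamily M c x P := by
  have key (k : Fin m) : ∃ P : (Fin n → ℤˣ) → A,
      (∀ χ, star (P χ) = P χ) ∧ (∀ χ, P χ * P χ = P χ) ∧
      (∑ χ : supp M k → ℤˣ, P (fun i => if h : i ∈ supp M k then χ ⟨i, h⟩ else 1) = 1) ∧
      (∀ χ, ∀ i ∈ supp M k, x i * P χ = χ i • P χ) ∧
      (∀ χ y, (∀ i, x i * y = y * x i) → P χ * y = y * P χ) ∧
      (∀ χ χ', (∀ i ∈ supp M k, χ i = χ' i) → P χ = P χ') := by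
    have hc : ∀ a ∈ x '' (supp M k : Set (Fin n)), ∀ d ∈ x '' (supp M k : Set (Fin n)),
        a * d = d * a := by
      rintro _ ⟨i, hi, rfl⟩ _ ⟨j, hj, rfl⟩
      exact h.comm k i j (mem_supp.1 hi) (mem_supp.1 hj)
    have hcs : ∀ a ∈ x '' (supp M k : Set (Fin n)), ∀ d ∈ x '' (supp M k : Set (Fin n)),
        a * star d = star d * a := by
      rintro _ ⟨i, hi, rfl⟩ _ ⟨j, hj, rfl⟩
      rw [hstar]
      exact h.comm k i j (mem_supp.1 hi) (mem_supp.1 hj)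
    have := StarAlgebra.isMulCommutative_adjoin ℂ hc hcs
    let C := StarAlgebra.adjoin ℂ (x '' (supp M k : Set (Fin n)))
    classical
    let w : Fin n → C := fun i => if hi : i ∈ supp M k then
      ⟨x i, StarAlgebra.subset_adjoin ℂ _ ⟨i, hi, rfl⟩⟩ else 0
    have hw (i) (hi : i ∈ supp M k) : (w i : A) = x i := by simp [w, hi]
    have hw2 : ∀ i ∈ supp M k, w i * w i = 1 := fun i hi => by
      apply Subtype.ext
      change (w i : A) * w i = 1
      rw [hw i hi, h.sq_eq]
    have hws : ∀ i ∈ supp M k, star (w i) = w i := fun i hi => by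
      apply Subtype.ext
      change star (w i : A) = w i
      rw [hw i hi, hstar]
    refine ⟨fun χ => (jointProj (supp M k) w χ : C), fun χ => ?_, fun χ => ?_, ?_,
      fun χ i hi => ?_, fun χ y hy => ?_, fun χ χ' hχ => ?_⟩
    · exact congrArg Subtype.val (star_jointProj hws χ)
    · exact congrArg Subtype.val (jointProj_mul_self hw2 χ)
    · have := congrArg C.subtype (sum_jointProj (supp M k) w)
      rw [map_sum, map_one] at this
      exact this
    · have := congrArg C.subtype (mul_jointProj hw2 χ hi)
      rw [map_mul] at this
      rw [← hw i hi]
      refine this.trans ?_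
      rcases Int.units_eq_one_or (χ i) with h | h <;> simp [h, Units.smul_def]
    · have hle : C ≤ StarSubalgebra.centralizer ℂ {y} := by
        refine StarAlgebra.adjoin_le ?_
        rintro _ ⟨i, -, rfl⟩
        rw [SetLike.mem_coe, StarSubalgebra.mem_centralizer_iff]
        rintro _ rfl
        refine ⟨(hy i).symm, ?_⟩
        have := congrArg star (hy i)
        rwa [star_mul, star_mul, hstar] at this
      exact ((StarSubalgebra.mem_centralizer_iff ℂ).1
        (hle (jointProj (supp M k) w χ).2) y rfl).1.symm
    · exact congrArg Subtype.val (Finset.prod_congr rfl fun i hi => by rw [hχ i hi])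
  choose P h1 h2 h3 h4 h5 h6 using key
  refine ⟨P, h1, h2, h3, h4, h5, h6, fun k χ hχ => ?_⟩
  have hl (l : List (Fin n)) (hl : ∀ i ∈ l, i ∈ supp M k) :
      (l.map x).prod * P k χ = (l.map χ).prod • P k χ := by
    induction l with
    | nil => simp
    | cons i l ih =>
      rw [List.map_cons, List.prod_cons, mul_assoc, ih fun j hj => hl j (List.mem_cons_of_mem _ hj),
        mul_smul_comm, h4 k χ i (hl i List.mem_cons_self), List.map_cons, List.prod_cons, mul_smul,
        smul_comm]
  have h7 : rowProd M x k * P k χ = rowProd M χ k • P k χ :=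
    hl _ fun i hi => by simpa [mem_supp] using hi
  rw [h.eqn, rowProd_eq_prod] at h7
  have h8 : ((-1 : ℤˣ) ^ (c k).val) • P k χ = -(((-1 : ℤˣ) ^ (c k).val) • P k χ) := by
    have h9 : ∏ i ∈ supp M k, χ i = -((-1) ^ (c k).val) := Int.units_ne_iff_eq_neg.1 hχ
    rw [h9] at h7
    simpa [Units.smul_def] using h7
  have h9 : ((-1 : ℤˣ) ^ (c k).val) • P k χ = 0 := by
    have h10 := eq_neg_iff_add_eq_zero.1 h8
    rw [← two_smul ℂ] at h10
    simpa using congrArg (fun a => (2⁻¹ : ℂ) • a) h10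
  rwa [smul_eq_zero_iff_eq] at h9

end Spectral

/-! ### From spectral projections to a perfect strategy. -/

section Strategy

variable {m n : ℕ} {M : Matrix (Fin m) (Fin n) (ZMod 2)} {b b' : Fin m → ZMod 2}
  {A : Type*} [Ring A]

/-- The operator assigned to a pair of vertices by a family of spectral projections. -/
def pairOp (P : Fin m → (Fin n → ℤˣ) → A) (g : SolVertex M b) (g' : SolVertex M b') : A :=
  if g.1 = g'.1 then P g.1 (fun i => sgn g i * sgn g' i) else 0

theorem pairOp_swap (P : Fin m → (Fin n → ℤˣ) → A) (g : SolVertex M b) (g' : SolVertex M b') :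
    pairOp P g g' = pairOp P g' g := by
  by_cases h : g.1 = g'.1
  · rw [pairOp, pairOp, if_pos h, if_pos h.symm, h]
    simp_rw [mul_comm]
  · rw [pairOp, pairOp, if_neg h, if_neg (Ne.symm h)]

/-- Multiplication by the signs of `g` embeds the vertices `g'` of the same row into the sign
patterns on that row. A missed pattern has the wrong product, so its projection is zero. -/
theorem SpectralFamily.sum_pairOp [StarRing A] {x : Fin n → A} {P : Fin m → (Fin n → ℤˣ) → A}
    (hP : SpectralFamily M (b + b') x P) (g : SolVertex M b) :
    ∑ g' : SolVertex M b', pairOp P g g' = 1 := by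
  classical
  simp only [pairOp]
  rw [← Finset.sum_filter, ← hP.sum_eq g.1]
  refine Finset.sum_of_injOn (fun g' (i : supp M g.1) => sgn g i * sgn g' i) ?_ (by simp) ?_ ?_
  · intro g' hg' h' hh' heq
    have hg1 : g.1 = g'.1 := by simpa using hg'
    have hh1 : g.1 = h'.1 := by simpa using hh'
    refine vertex_ext (hg1.symm.trans hh1) fun i hi => ?_
    rw [← hg1] at hi
    exact mul_left_cancel (congrFun heq ⟨i, hi⟩)
  · intro χ _ hχ
    refine hP.eq_zero _ _ fun hprod => hχ ?_
    have h1 : ∏ i ∈ supp M g.1, (sgn g i * if h : i ∈ supp M g.1 then χ ⟨i, h⟩ else 1) =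
        (-1) ^ (b' g.1).val := by
      rw [Finset.prod_mul_distrib, hprod, prod_sgn, Pi.add_apply, ← neg_one_pow_val_add,
        ← mul_assoc, Int.units_mul_self, one_mul]
    obtain ⟨g', hg', hs⟩ := exists_vertex _ h1
    refine ⟨g', by simp [hg'], funext fun i => ?_⟩
    change sgn g i * sgn g' i = χ i
    rw [hs i i.2, dif_pos i.2, ← mul_assoc, Int.units_mul_self, one_mul]
  · intro g' hg'
    refine hP.congr _ _ _ fun i hi => ?_
    rw [dif_pos hi]

/-- The operator for the answer `y` to the question `x` in the isomorphism game. -/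
def answerOp (P : Fin m → (Fin n → ℤˣ) → A) :
    SolVertex M b ⊕ SolVertex M b' → SolVertex M b ⊕ SolVertex M b' → A
  | .inl g, .inr g' => pairOp P g g'
  | .inr g', .inl g => pairOp P g g'
  | _, _ => 0

theorem answerOp_cases (P : Fin m → (Fin n → ℤˣ) → A) (x y : SolVertex M b ⊕ SolVertex M b') :
    answerOp P x y = 0 ∨ ∃ g g', Pairs x y g g' ∧ g.1 = g'.1 ∧
      answerOp P x y = P g.1 (fun i => sgn g i * sgn g' i) := by
  have h (g : SolVertex M b) (g' : SolVertex M b') : pairOp P g g' = 0 ∨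
      g.1 = g'.1 ∧ pairOp P g g' = P g.1 (fun i => sgn g i * sgn g' i) := by
    by_cases hg : g.1 = g'.1
    · exact .inr ⟨hg, if_pos hg⟩
    · exact .inl (if_neg hg)
  rcases x with g | g' <;> rcases y with h1 | h1
  · exact .inl rfl
  · exact (h g h1).imp id fun h2 => ⟨g, h1, .inl ⟨rfl, rfl⟩, h2⟩
  · exact (h h1 g').imp id fun h2 => ⟨h1, g', .inr ⟨rfl, rfl⟩, h2⟩
  · exact .inl rfl

theorem SpectralFamily.sum_answerOp [StarRing A] {x : Fin n → A} {P : Fin m → (Fin n → ℤˣ) → A}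
    (hP : SpectralFamily M (b + b') x P) (q : SolVertex M b ⊕ SolVertex M b') :
    ∑ y, answerOp P q y = 1 := by
  rcases q with g | g'
  · rw [Fintype.sum_sum_type, ← hP.sum_pairOp g]
    exact add_eq_right.2 (Finset.sum_eq_zero fun _ _ => rfl)
  · rw [add_comm] at hP
    rw [Fintype.sum_sum_type, ← hP.sum_pairOp g']
    refine (add_eq_left.2 (Finset.sum_eq_zero fun _ _ => rfl)).trans ?_
    exact Finset.sum_congr rfl fun g _ => pairOp_swap P g g'

theorem SpectralFamily.isPositive_answerOp {H : Type*} [NormedAddCommGroup H]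
    [InnerProductSpace ℂ H] [CompleteSpace H] {c : Fin m → ZMod 2} {x : Fin n → H →L[ℂ] H}
    {P : Fin m → (Fin n → ℤˣ) → H →L[ℂ] H} (hP : SpectralFamily M c x P)
    (q y : SolVertex M b ⊕ SolVertex M b') : (answerOp P q y).IsPositive := by
  rcases answerOp_cases P q y with h | ⟨g, g', -, -, h⟩
  · rw [h]; exact ContinuousLinearMap.isPositive_zero
  · rw [h]; exact .of_isStarProjection ⟨hP.mul_self _ _, hP.star_eq _ _⟩

theorem answerOp_commute {P Q : Fin m → (Fin n → ℤˣ) → A}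
    (hPQ : ∀ k χ l ω, P k χ * Q l ω = Q l ω * P k χ) (q y q' y' : SolVertex M b ⊕ SolVertex M b') :
    Commute (answerOp P q y) (answerOp Q q' y') := by
  rcases answerOp_cases P q y with h | ⟨g, g', -, -, h⟩
  · rw [h]; exact Commute.zero_left _
  rcases answerOp_cases Q q' y' with h' | ⟨g, g', -, -, h'⟩
  · rw [h']; exact Commute.zero_right _
  rw [h, h']
  exact hPQ _ _ _ _

/-- Two commuting representations of the relations, by operators which agree on a unit vector,
give rise to a perfect strategy for the isomorphism game. -/
theorem quantumIsomorphic_of_commuting_reps {H : Type v} [NormedAddCommGroup H]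
    [InnerProductSpace ℂ H] [CompleteSpace H] {x y : Fin n → H →L[ℂ] H} {ψ : H} (hψ : ‖ψ‖ = 1)
    (hx : RingRel M (b + b') x) (hy : RingRel M (b + b') y) (hxs : ∀ i, star (x i) = x i)
    (hys : ∀ i, star (y i) = y i) (hxy : ∀ i j, x i * y j = y j * x i)
    (hψxy : ∀ i, x i ψ = y i ψ) :
    QuantumIsomorphic.{v} (solGraph M b) (solGraph M b') := by
  obtain ⟨P, hP⟩ := hx.exists_spectralFamily hxs
  obtain ⟨Q, hQ⟩ := hy.exists_spectralFamily hys
  have hPy (k χ j) : P k χ * y j = y j * P k χ := hP.commute k χ _ fun i => hxy i j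
  have hQx (k χ j) : Q k χ * x j = x j * Q k χ := hQ.commute k χ _ fun i => (hxy j i).symm
  have hPQ (k χ l ω) : P k χ * Q l ω = Q l ω * P k χ :=
    (hQ.commute l ω _ fun i => (hPy k χ i).symm).symm
  -- Evaluate `P (x_i (Q ψ))` in two ways: `P` absorbs `x_i` as `χ i`, while moving `x_i` past `Q`
  -- to `ψ` turns it into `y_i`, which `Q` absorbs as `ω i`. Opposite signs force zero.
  have horth (k χ l ω) (i : Fin n) (hk : i ∈ supp M k) (hl : i ∈ supp M l) (hne : χ i ≠ ω i) :
      P k χ (Q l ω ψ) = 0 := by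
    have h1 (φ) : P k χ (x i φ) = χ i • P k χ φ :=
      congrArg (fun T : H →L[ℂ] H => T φ) (hP.eigen_right hxs χ hk)
    have h2 : Q l ω (y i ψ) = ω i • Q l ω ψ :=
      congrArg (fun T : H →L[ℂ] H => T ψ) (hQ.eigen_right hys ω hl)
    have h3 : Q l ω (x i ψ) = x i (Q l ω ψ) :=
      congrArg (fun T : H →L[ℂ] H => T ψ) (hQx l ω i)
    have h4 : ω i • P k χ (Q l ω ψ) = χ i • P k χ (Q l ω ψ) := by
      rw [← h1, ← h3, hψxy, h2]
      exact ((P k χ).toLinearMap.toAddMonoidHom.map_zsmul _ _).symm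
    rw [Int.units_ne_iff_eq_neg.1 hne, Units.neg_smul, eq_neg_iff_add_eq_zero, ← two_smul ℂ,
      smul_eq_zero_iff_right two_ne_zero, smul_eq_zero_iff_eq] at h4
    exact h4
  refine ⟨{ H := H
            state := ψ
            norm_state := hψ
            alice := answerOp P
            bob := answerOp Q
            alice_pos := hP.isPositive_answerOp
            bob_pos := hQ.isPositive_answerOp
            alice_sum := hP.sum_answerOp
            bob_sum := hQ.sum_answerOp
            commute := answerOp_commute hPQ }, CommutingStrategy.isPerfect_iff.2 ?_⟩
  intro xA xB yA yB hlose
  change answerOp P xA yA (answerOp Q xB yB ψ) = 0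
  rcases answerOp_cases P xA yA with h | ⟨g, g', hA, hg, h⟩
  · rw [h]; rfl
  rcases answerOp_cases Q xB yB with h' | ⟨l, l', hB, hl, h'⟩
  · rw [h']; exact map_zero _
  rw [h, h']
  have hc : ∃ i ∈ supp M g.1 ∩ supp M l.1, sgn g i * sgn g' i ≠ sgn l i * sgn l' i := by
    by_contra! hc
    exact hlose (isoGameWin_iff.2 ⟨g, l, g', l', hA, hB, hg, hl, hc⟩)
  obtain ⟨i, hi, hne⟩ := hc
  exact horth _ _ _ _ i (Finset.mem_inter.1 hi).1 (Finset.mem_inter.1 hi).2 hne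

theorem ringRel_of_solGroup {c : Fin m → ZMod 2} {R : Type*} [Ring R] (f : SolGroup M c →* R)
    (hf : f (SolGroup.gamma M c) = -1) :
    RingRel M c fun i => f (PresentedGroup.of (some i)) where
  sq_eq i := by rw [← map_mul, solGroup_gen_sq, map_one]
  comm k i j hi hj := by rw [← map_mul, solGroup_gen_comm hi hj, map_mul]
  eqn k := by rw [← map_rowProd f, solGroup_rowProd, map_pow, hf]

theorem quantumIsomorphic_of_gamma_ne_one (h : SolGroup.gamma M (b + b') ≠ 1) :
    QuantumIsomorphic.{v} (solGraph M b) (solGraph M b') := by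
  obtain ⟨H, _, _, _, L, R, ψ, hψ, hL, hR, hLR, hLs, hRs, hψLR⟩ :=
    exists_biregular_rep.{v} (SolGroup.gamma M (b + b')) solGroup_gamma_central solGroup_gamma_sq h
  exact quantumIsomorphic_of_commuting_reps hψ (ringRel_of_solGroup L hL)
    (ringRel_of_solGroup R hR) (fun i => hLs _ (solGroup_gen_sq i))
    (fun i => hRs _ (solGroup_gen_sq i)) (fun i j => hLR _ _) fun i => hψLR _ (solGroup_gen_sq i)

end Strategy

/-! ### Nontriviality of the universal algebra. -/

section Algebra

variable {m n : ℕ} {M : Matrix (Fin m) (Fin n) (ZMod 2)} {c : Fin m → ZMod 2}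

/-- Left translations form a representation in the bounded operators on a nonzero Hilbert space, and
a unital homomorphism to a nonzero ring has a nonzero domain. -/
theorem nontrivial_solAlg_of_gamma_ne_one (h : SolGroup.gamma M c ≠ 1) :
    Nontrivial (SolAlg.{u} M c) := by
  obtain ⟨H, _, _, _, L, R, ψ, hψ, hL, -, -, hLs, -⟩ :=
    exists_biregular_rep.{u} (SolGroup.gamma M c) solGroup_gamma_central solGroup_gamma_sq h
  have hψ0 : ψ ≠ 0 := fun h0 => by simp [h0] at hψ
  have : Nontrivial H := ⟨⟨ψ, 0, hψ0⟩⟩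
  have hrel := ringRel_of_solGroup L hL
  let r : SolRep.{u} M c :=
    { alg := H →L[ℂ] H
      gen := fun i => L (PresentedGroup.of (some i))
      rel :=
        { star_eq := fun i => hLs _ (solGroup_gen_sq i)
          sq_eq := fun i => by rw [sq]; exact hrel.sq_eq i
          comm := fun i j ⟨k, hi, hj⟩ => hrel.comm k i j hi hj
          eqn := hrel.eqn } }
  exact (SolAlg.eval M c r).toRingHom.domain_nontrivial

theorem gamma_ne_one_of_nontrivial_solAlg (hc : c ≠ 0) (h : Nontrivial (SolAlg.{u} M c)) :
    SolGroup.gamma M c ≠ 1 := by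
  have hrel : RingRel M c (SolAlg.gen.{u} M c) :=
    { sq_eq := fun i => by rw [← sq]; exact (SolAlg.rel M c).sq_eq i
      comm := fun k i j hi hj => (SolAlg.rel M c).comm i j ⟨k, hi, hj⟩
      eqn := (SolAlg.rel M c).eqn }
  refine hrel.gamma_ne_one hc fun h => ?_
  -- In a nonzero complex algebra the scalars embed, so `-1 = 1` would already hold in `ℂ`.
  have h2 : algebraMap ℂ (SolAlg.{u} M c) (-1) = algebraMap ℂ (SolAlg.{u} M c) 1 := by simpa using h
  have := (algebraMap ℂ (SolAlg.{u} M c)).injective h2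
  norm_num at this

end Algebra

end QIso

theorem corollary6p7 {m n : ℕ} (M : Matrix (Fin m) (Fin n) (ZMod 2)) (b b' : Fin m → ZMod 2)
    (hb : b ≠ b') :
    [ QIso.QuantumIsomorphic.{v} (QIso.solGraph M b) (QIso.solGraph M b'),
      Nontrivial (QIso.SolAlg.{u} M (b + b')),
      QIso.SolGroup.gamma M (b + b') ≠ 1 ].TFAE := by
  tfae_have 1 → 3 := QIso.QuantumIsomorphic.gamma_ne_one hb
  tfae_have 3 → 1 := QIso.quantumIsomorphic_of_gamma_ne_one
  tfae_have 3 → 2 := QIso.nontrivial_solAlg_of_gamma_ne_one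
  tfae_have 2 → 3 := QIso.gamma_ne_one_of_nontrivial_solAlg fun h0 => hb <| funext fun k =>
    CharTwo.add_eq_zero.1 (congrFun h0 k)
  tfae_finish
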